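/- Let $\mu$ be an infinite cardinal with $\mu^{<\mu}=\mu$, let $\lambda=\mu^+$ and $\kappa=\lambda^+$. For a set $X$ of ordinals let $[X]^n$ denote the set of its $n$-element subsets, each identified with its increasing enumeration $(\alpha_1,\dots,\alpha_n)$, $\alpha_1<\dots<\alpha_n$. Suppose that: * $\varrho:[\kappa]^2\to\lambda$ is subadditive, i.e. for all $\alpha<\beta<\gamma<\kappa$ both $\varrho(\alpha,\gamma)\le\max\{\varrho(\alpha,\beta),\varrho(\beta,\gamma)\}$ and $\varrho(\alpha,\beta)\le\max\{\varrho(\alpha,\gamma),\varrho(\beta,\gamma)\}$; * $\lambda\nrightarrow[\mu;\lambda]^2_\lambda$ holds, i.e. there is a coloring $d:[\lambda]^2\to\lambda$ such that for every $A\subseteq\lambda$ with $|A|=\mu$ and every $B\subseteq\lambda$ with $|B|=\lambda$, $\{d(\alpha,\beta) : \alpha\in A,\ \beta\in B,\ \alpha<\beta\}=\lambda$. Then there exists a coloring $c:[\kappa]^3\to\lambda$ such that for every $\tau<\lambda$ and all disjoint $A,B\subseteq\kappa$ satisfying 1. $\operatorname{otp}(A)=\operatorname{otp}(B)=\lambda$,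 2. $\sup(A)=\sup(B)$, 3. $\varrho\restriction[A\cup B]^2$ witnesses $\mathrm{U}(\lambda,\lambda,\lambda,3)$, there is $(\alpha,\beta,\gamma)\in[A\cup B]^3\setminus([A]^3\cup[B]^3)$ with $c(\alpha,\beta,\gamma)=\tau$. Here a coloring $e:[\lambda]^2\to\lambda$ witnesses $\mathrm{U}(\lambda,\lambda,\lambda,3)$ if for every cardinal $\sigma<3$, every family $\mathcal A$ of $\lambda$ many pairwise disjoint subsets of $\lambda$, each of size $\sigma$, and every $\tau<\lambda$, there is $\mathcal B\subseteq\mathcal A$ of size $\lambda$ such that $e(\{\alpha,\beta\})>\tau$ for all distinct $a,b\in\mathcal B$ and all $\alpha\in a$, $\beta\in b$. Condition 3 means that $A\cup B$ has order type $\lambda$ and that, for the order-preserving bijection $\pi:\lambda\to A\cup B$, the coloring $(\alpha,\beta)\mapsto\varrho(\pi(\alpha),\pi(\beta))$ witnesses $\mathrm{U}(\lambda,\lambda,\lambda,3)$. -/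

import Mathlib

open Cardinal Ordinal Set

universe u

/-- `S` has cardinality `k`. Sets of (sets of) ordinals live one universe above the cardinals
that measure them, hence the lift. -/
def HasCard {X : Type (u + 1)} (S : Set X) (k : Cardinal.{u}) : Prop :=
  #S = Cardinal.lift.{u + 1} k

/-- A set of ordinals `A` has order type `o`. -/
def HasOrderType (A : Set Ordinal.{u}) (o : Ordinal.{u}) : Prop :=
  Ordinal.type (fun a b : A => a < b) = Ordinal.lift.{u + 1} o

/-- The set `A ⊛ B` of increasing pairs `(α, β)` with `α ∈ A` and `β ∈ B`. -/
def incPairs (A B : Set Ordinal.{u}) : Set (Ordinal.{u} × Ordinal.{u}) :=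
  {p | p.1 ∈ A ∧ p.2 ∈ B ∧ p.1 < p.2}

/-- The set `[X]³`, each triple being listed increasingly. -/
def incTriples (X : Set Ordinal.{u}) : Set (Ordinal.{u} × Ordinal.{u} × Ordinal.{u}) :=
  {p | p.1 ∈ X ∧ p.2.1 ∈ X ∧ p.2.2 ∈ X ∧ p.1 < p.2.1 ∧ p.2.1 < p.2.2}

/-- `c` is a coloring `[κ]² → θ`. A coloring of pairs is given by a function of two ordinals, of
which only the values at `(α, β)` with `α < β < κ` matter. -/
def IsPairColoring (κ θ : Cardinal.{u}) (c : Ordinal.{u} → Ordinal.{u} → Ordinal.{u}) : Prop :=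
  ∀ p ∈ incPairs (Iio κ.ord) (Iio κ.ord), c p.1 p.2 < θ.ord

/-- `c` is a coloring `[κ]³ → θ`; only its values at `(α, β, γ)` with `α < β < γ < κ` matter. -/
def IsTripleColoring (κ θ : Cardinal.{u})
    (c : Ordinal.{u} → Ordinal.{u} → Ordinal.{u} → Ordinal.{u}) : Prop :=
  ∀ p ∈ incTriples (Iio κ.ord), c p.1 p.2.1 p.2.2 < θ.ord

/-- Subadditivity of a coloring of `[κ]²`. -/
def IsSubadditive (κ : Cardinal.{u}) (c : Ordinal.{u} → Ordinal.{u} → Ordinal.{u}) : Prop :=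
  ∀ α β γ : Ordinal.{u}, α < β → β < γ → γ < κ.ord →
    c α γ ≤ max (c α β) (c β γ) ∧ c α β ≤ max (c α γ) (c β γ)

/-- The negative square-bracket relation `κ ↛ [k₁; k₂]²_θ`. -/
def NegSquareBracket (κ k₁ k₂ θ : Cardinal.{u}) : Prop :=
  ∃ c : Ordinal.{u} → Ordinal.{u} → Ordinal.{u}, IsPairColoring κ θ c ∧
    ∀ A B : Set Ordinal.{u}, A ⊆ Iio κ.ord → B ⊆ Iio κ.ord → HasCard A k₁ → HasCard B k₂ →
      (fun p : Ordinal.{u} × Ordinal.{u} => c p.1 p.2) '' incPairs A B = Iio θ.ord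

/-- `c` witnesses `U(κ, μ, θ, χ)`. The color of the unordered pair `{α, β}` is
`c (min α β) (max α β)`. -/
def WitnessesU (κ μ θ χ : Cardinal.{u}) (c : Ordinal.{u} → Ordinal.{u} → Ordinal.{u}) : Prop :=
  IsPairColoring κ θ c ∧
  ∀ σ < χ, ∀ F : Set (Set Ordinal.{u}),
    (∀ a ∈ F, a ⊆ Iio κ.ord ∧ HasCard a σ) →
    (∀ a ∈ F, ∀ b ∈ F, a ≠ b → Disjoint a b) →
    HasCard F κ →
    ∀ τ < θ.ord, ∃ G ⊆ F, HasCard G μ ∧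
      ∀ a ∈ G, ∀ b ∈ G, a ≠ b → ∀ α ∈ a, ∀ β ∈ b, τ < c (min α β) (max α β)

/-- `c ↾ [X]²` witnesses `U(k, μ, θ, χ)`, for a set `X` of order type `k`: the pullback of `c`
along the increasing bijection `π : k → X` witnesses it. -/
def RestrictionWitnessesU (X : Set Ordinal.{u}) (k μ θ χ : Cardinal.{u})
    (c : Ordinal.{u} → Ordinal.{u} → Ordinal.{u}) : Prop :=
  ∃ π : Ordinal.{u} → Ordinal.{u}, StrictMonoOn π (Iio k.ord) ∧ π '' Iio k.ord = X ∧
    WitnessesU k μ θ χ (fun α β => c (π α) (π β))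

-- Fix injections `e δ` of `δ < κ` into `lam`; each `codedBelow e δ i` with `i < lam` has size at
-- most `μ`. `exists_coherent_codes` puts on these sets functions `f δ i` into `μ` that take values
-- below any bound fewer than `μ` times, any two agreeing off fewer than `μ` common points. With `z
-- = max (rho β γ) (e γ β)`, color `(α, β, γ)` by `d (f β (succ z) α) z`.
--
-- A set `X` of size `μ` lies in a single `codedBelow e δ i`. By `exists_color_of_large`, once `z`
-- is large, `d (f δ i α) z = τ` for some `α ∈ X` outside any prescribed set of size less than `μ`;
-- coherence replaces `f δ i` by `f β (succ z)`, provided `z` bounds the codes `e β α` of `X`.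
--
-- It remains to find `X ⊆ A`, `β` and `γ ∈ B` with `z` large and above those codes. Either some
-- fixed `β` has `z β γ` unbounded over `γ ∈ B`, or these values are bounded for each `β`; then the
-- codes of a suitable `X` are bounded uniformly over `β ∈ B`, and condition U makes `rho β γ`
-- large.

universe v

/-! ### Coherent families of functions with small sublevel sets. -/

section Coherent

variable {S M : Type v} [LinearOrder M] [WellFoundedLT M]

/-- One step of the recursion: each point copies the `g i` of least rank `r i` whose domain contains
it. Only fewer than `m` indices have rank at most a given value, so regularity keeps all exceptional
sets small. -/
theorem exists_coherent_amalgam {ι : Type v} {m : Cardinal.{v}} (hm : m.IsRegular)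
    (hM : ∀ ν : M, #(Iic ν) < m) (D : Set S) (e : S → M) (he : InjOn e D)
    (r : ι → M) (hr : Function.Injective r) (E : ι → Set S) (g : ι → S → M)
    (hg : ∀ i ν, #{x | x ∈ E i ∧ g i x ≤ ν} < m)
    (hgg : ∀ i j, #{x | x ∈ E i ∧ x ∈ E j ∧ g i x ≠ g j x} < m) :
    ∃ f : S → M, (∀ ν, #{x | x ∈ D ∧ f x ≤ ν} < m) ∧
      ∀ i, #{x | x ∈ D ∧ x ∈ E i ∧ f x ≠ g i x} < m := by
  classical
  have hmin : ∀ x, (∃ i, x ∈ E i) → ∃ i, x ∈ E i ∧ ∀ k, x ∈ E k → r i ≤ r k := by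
    rintro x ⟨i, hi⟩
    obtain ⟨_, ⟨i₀, hi₀, rfl⟩, hmin⟩ := WellFounded.has_min (wellFounded_lt (α := M))
      (r '' {i | x ∈ E i}) ⟨_, i, hi, rfl⟩
    exact ⟨i₀, hi₀, fun k hk => not_lt.1 (hmin _ ⟨k, hk, rfl⟩)⟩
  choose J hJ hJmin using hmin
  have hIic : ∀ ν, #{i | r i ≤ ν} < m := fun ν =>
    (mk_le_of_injective (f := fun i : {i | r i ≤ ν} => (⟨r i, i.2⟩ : Iic ν))
      fun a b h => Subtype.ext (hr (congrArg Subtype.val h))).trans_lt (hM ν)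
  have hunion : ∀ {a b : Set S}, #a < m → #b < m → #(a ∪ b : Set S) < m := fun ha hb =>
    (mk_union_le _ _).trans_lt (add_lt_of_lt hm.aleph0_le ha hb)
  -- The maximum with the rank ensures that a value at most `ν` involves only indices of rank at
  -- most `ν`.
  refine ⟨fun x => if h : ∃ i, x ∈ E i then max (g (J x h) x) (r (J x h)) else e x,
    fun ν => ?_, fun i => ?_⟩
  · refine (mk_le_mk_of_subset (t := (⋃ i ∈ {i | r i ≤ ν}, {x | x ∈ E i ∧ g i x ≤ ν}) ∪
      {x | x ∈ D ∧ e x ≤ ν}) ?_).trans_lt (hunion ?_ ?_)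
    · rintro x ⟨hxD, hx⟩
      by_cases h : ∃ i, x ∈ E i
      · simp only [h, dif_pos, max_le_iff] at hx
        exact Or.inl (mem_biUnion (show J x h ∈ {i | r i ≤ ν} from hx.2) ⟨hJ x h, hx.1⟩)
      · simp only [h, dif_neg, not_false_eq_true] at hx
        exact Or.inr ⟨hxD, hx⟩
    · exact (card_biUnion_lt_iff_forall_of_isRegular hm (hIic ν)).2 fun i _ => hg i ν
    · exact (mk_le_of_injective (f := fun x : {x | x ∈ D ∧ e x ≤ ν} => (⟨e x, x.2.2⟩ : Iic ν))
        fun a b h => Subtype.ext (he a.2.1 b.2.1 (congrArg Subtype.val h))).trans_lt (hM ν)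
  · refine (mk_le_mk_of_subset (t := ⋃ k ∈ {k | r k ≤ r i},
      ({x | x ∈ E k ∧ x ∈ E i ∧ g k x ≠ g i x} ∪ {x | x ∈ E k ∧ g k x ≤ r i})) ?_).trans_lt ?_
    · rintro x ⟨-, hxi, hx⟩
      have h : ∃ i, x ∈ E i := ⟨i, hxi⟩
      simp only [h, dif_pos] at hx
      have hle := hJmin x h i hxi
      refine mem_biUnion (show J x h ∈ {k | r k ≤ r i} from hle) ?_
      by_cases hgk : g (J x h) x = g i x
      · refine Or.inr ⟨hJ x h, le_of_not_gt fun hlt => hx ?_⟩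
        rw [max_eq_left (hle.trans hlt.le), hgk]
      · exact Or.inl ⟨hJ x h, hxi, hgk⟩
    · exact (card_biUnion_lt_iff_forall_of_isRegular hm (hIic _)).2 fun k _ =>
        hunion (hgg k i) (hg k _)

/-- Stage `i` may have too many predecessors to amalgamate; `H` is a small set of them whose domains
cover every trace `D j ∩ D i`, and coherence with the others passes through `H`. -/
theorem exists_coherent_family [Nonempty M] {I : Type v} [LinearOrder I] [WellFoundedLT I]
    {m : Cardinal.{v}} (hm : m.IsRegular) (hM : ∀ ν : M, #(Iic ν) < m) (D : I → Set S)
    (hD : ∀ i, #(D i) ≤ #M)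
    (hH : ∀ i, ∃ H ⊆ Iio i, #H ≤ #M ∧ ∀ j < i, ∃ k ∈ H, D j ∩ D i ⊆ D k) :
    ∃ f : I → S → M, (∀ i ν, #{x | x ∈ D i ∧ f i x ≤ ν} < m) ∧
      ∀ i j, #{x | x ∈ D i ∧ x ∈ D j ∧ f i x ≠ f j x} < m := by
  classical
  let P : ∀ i : I, (∀ j, j < i → S → M) → (S → M) → Prop := fun i g h =>
    (∀ ν, #{x | x ∈ D i ∧ h x ≤ ν} < m) ∧
      ∀ j (hj : j < i), #{x | x ∈ D i ∧ x ∈ D j ∧ h x ≠ g j hj x} < m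
  -- The constant default is never reached: `hP` shows that a suitable function exists at every
  -- stage.
  let F : I → S → M := (wellFounded_lt (α := I)).fix fun i g =>
    if h : ∃ h, P i g h then h.choose else fun _ => Classical.arbitrary M
  have hF : ∀ i, F i = if h : ∃ h, P i (fun j _ => F j) h then h.choose
      else fun _ => Classical.arbitrary M := fun i => WellFounded.fix_eq _ _ i
  have hP : ∀ i, P i (fun j _ => F j) (F i) := by
    intro i
    induction i using (wellFounded_lt (α := I)).induction with
    | _ i ih =>
    suffices h : ∃ h, P i (fun j _ => F j) h by
      rw [hF i, dif_pos h]
      exact h.choose_spec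
    obtain ⟨H, hHi, hHM, hHc⟩ := hH i
    obtain ⟨r⟩ : Nonempty (H ↪ M) := hHM
    obtain ⟨e⟩ : Nonempty (D i ↪ M) := hD i
    have hsymm : ∀ j k, #{x | x ∈ D j ∧ x ∈ D k ∧ F j x ≠ F k x} < m →
        #{x | x ∈ D k ∧ x ∈ D j ∧ F k x ≠ F j x} < m := fun j k h => by
      refine (mk_le_mk_of_subset ?_).trans_lt h
      rintro x ⟨h1, h2, h3⟩
      exact ⟨h2, h1, h3.symm⟩
    have hco : ∀ j < i, ∀ k < i, #{x | x ∈ D j ∧ x ∈ D k ∧ F j x ≠ F k x} < m := by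
      intro j hj k hk
      rcases lt_trichotomy j k with h | rfl | h
      · exact hsymm _ _ ((ih k hk).2 j h)
      · simpa using hm.pos
      · exact (ih j hj).2 k h
    obtain ⟨f, hf, hff⟩ := exists_coherent_amalgam hm hM (D i)
      (fun x => if h : x ∈ D i then e ⟨x, h⟩ else Classical.arbitrary M)
      (fun x hx y hy h => by
        simp only [hx, hy, dif_pos] at h
        exact congrArg Subtype.val (e.injective h))
      r r.injective (fun k => D k) (fun k => F k) (fun k => (ih k (hHi k.2)).1)
      (fun j k => hco j (hHi j.2) k (hHi k.2))
    refine ⟨f, hf, fun j hj => ?_⟩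
    obtain ⟨k, hk, hjk⟩ := hHc j hj
    refine (mk_le_mk_of_subset (t := {x | x ∈ D i ∧ x ∈ D k ∧ f x ≠ F k x} ∪
      {x | x ∈ D k ∧ x ∈ D j ∧ F k x ≠ F j x}) ?_).trans_lt
        ((mk_union_le _ _).trans_lt (add_lt_of_lt hm.aleph0_le (hff ⟨k, hk⟩)
          (hco k (hHi hk) j hj)))
    rintro x ⟨hxi, hxj, hx⟩
    have hxk := hjk ⟨hxj, hxi⟩
    by_cases h : f x = F k x
    · exact Or.inr ⟨hxk, hxj, fun h' => hx (h.trans h')⟩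
    · exact Or.inl ⟨hxi, hxk, h⟩
  refine ⟨F, fun i => (hP i).1, fun i j => ?_⟩
  rcases lt_trichotomy i j with h | rfl | h
  · refine (mk_le_mk_of_subset ?_).trans_lt ((hP j).2 i h)
    rintro x ⟨h1, h2, h3⟩
    exact ⟨h2, h1, h3.symm⟩
  · simpa using hm.pos
  · exact (hP i).2 j h

end Coherent

/-! ### Regularity and bounds. -/

theorem exists_strict_upper_bound {S : Type v} [LinearOrder S] {m : Cardinal.{v}}
    (hm : m.IsRegular) {X Y : Set S} (hX : m ≤ #X) (hY : #Y < m)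
    (hXY : ∀ y ∈ Y, #(X ∩ Iic y : Set S) < m) : ∃ x ∈ X, ∀ y ∈ Y, y < x := by
  by_contra! h
  refine hX.not_gt ((mk_le_mk_of_subset (t := ⋃ y ∈ Y, X ∩ Iic y) fun x hx => ?_).trans_lt
    ((card_biUnion_lt_iff_forall_of_isRegular hm hY).2 hXY))
  obtain ⟨y, hy, hxy⟩ := h x hx
  exact mem_biUnion hy ⟨hx, hxy⟩

/-- By König, `μ` is less than its power to its cofinality. -/
theorem isRegular_of_powerlt_eq {μ : Cardinal.{u}} (hμ : ℵ₀ ≤ μ) (hpow : μ ^< μ = μ) :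
    μ.IsRegular := by
  refine ⟨hμ, le_of_not_gt fun h => ?_⟩
  exact ((lt_power_cof_ord hμ).trans_le (le_powerlt μ h)).ne' hpow

theorem mk_Iic_lt_lift {c : Cardinal.{u}} (hc : ℵ₀ ≤ c) {o : Ordinal.{u}} (ho : o < c.ord) :
    #(Iic o) < Cardinal.lift.{u + 1} c := by
  rw [← Order.Iio_succ, Cardinal.mk_Iio_ordinal, Cardinal.lift_lt, ← lt_ord]
  exact (isSuccLimit_ord hc).succ_lt ho

theorem mk_Iio_ord_eq (c : Cardinal.{u}) : #(Iio c.ord) = Cardinal.lift.{u + 1} c := by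
  rw [Cardinal.mk_Iio_ordinal, card_ord]

theorem exists_bound_lt_ord {c : Cardinal.{u}} (hc : c.IsRegular) {Y : Set Ordinal.{u}}
    (hY : Y ⊆ Iio c.ord) (hYc : #Y < Cardinal.lift.{u + 1} c) :
    ∃ b < c.ord, ∀ y ∈ Y, y < b :=
  exists_strict_upper_bound hc.lift (mk_Iio_ord_eq c).ge hYc fun _ hy =>
    (mk_le_mk_of_subset inter_subset_right).trans_lt (mk_Iic_lt_lift hc.aleph0_le (hY hy))

/-! ### Codes of ordinals and coherent functions on coded sets. -/

theorem mk_Iio_le_of_lt_ord_succ {c : Cardinal.{u}} {o : Ordinal.{u}}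
    (ho : o < (Order.succ c).ord) : #(Iio o) ≤ Cardinal.lift.{u + 1} c := by
  rw [Cardinal.mk_Iio_ordinal, Cardinal.lift_le]
  exact Order.lt_succ_iff.1 (lt_ord.1 ho)

theorem exists_injOn_Iio (c : Cardinal.{u}) :
    ∃ e : Ordinal.{u} → Ordinal.{u} → Ordinal.{u}, ∀ δ < (Order.succ c).ord,
      InjOn (e δ) (Iio δ) ∧ MapsTo (e δ) (Iio δ) (Iio c.ord) := by
  have h : ∀ δ : Ordinal.{u}, ∃ e : Ordinal.{u} → Ordinal.{u}, δ < (Order.succ c).ord →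
      InjOn e (Iio δ) ∧ MapsTo e (Iio δ) (Iio c.ord) := by
    classical
    intro δ
    by_cases hδ : δ < (Order.succ c).ord
    · have := mk_Iio_le_of_lt_ord_succ hδ
      rw [← mk_Iio_ord_eq] at this
      obtain ⟨g⟩ : Nonempty (Iio δ ↪ Iio c.ord) := this
      refine ⟨fun α => if h : α ∈ Iio δ then g ⟨α, h⟩ else 0, fun _ => ⟨?_, ?_⟩⟩
      · intro x hx y hy h
        simp only [hx, hy, dif_pos] at h
        exact congrArg Subtype.val (g.injective (Subtype.ext h))
      · intro x hx
        simp only [hx, dif_pos]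
        exact (g ⟨x, hx⟩).2
    · exact ⟨id, fun h => absurd h hδ⟩
  choose e he using h
  exact ⟨e, he⟩

/-- The set of the `α < δ` whose code `e δ α` is below `i`. -/
def codedBelow (e : Ordinal.{u} → Ordinal.{u} → Ordinal.{u}) (δ i : Ordinal.{u}) :
    Set Ordinal.{u} :=
  {α | α < δ ∧ e δ α < i}

theorem mk_codedBelow_le {c : Cardinal.{u}} {e : Ordinal.{u} → Ordinal.{u} → Ordinal.{u}}
    {δ i : Ordinal.{u}} (he : InjOn (e δ) (Iio δ)) (hi : i < (Order.succ c).ord) :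
    #(codedBelow e δ i) ≤ Cardinal.lift.{u + 1} c :=
  (mk_le_of_injective (f := fun α : codedBelow e δ i => (⟨e δ α, α.2.2⟩ : Iio i))
    fun a b h => Subtype.ext (he a.2.1 b.2.1 (congrArg Subtype.val h))).trans
    (mk_Iio_le_of_lt_ord_succ hi)

theorem exists_code_bound {c k : Cardinal.{u}} (hc : c.IsRegular)
    {e : Ordinal.{u} → Ordinal.{u} → Ordinal.{u}}
    (he : ∀ δ < k.ord, InjOn (e δ) (Iio δ) ∧ MapsTo (e δ) (Iio δ) (Iio c.ord))
    {Y : Set Ordinal.{u}} (hY : #Y < Cardinal.lift.{u + 1} c) {δ : Ordinal.{u}} (hδ : δ < k.ord) :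
    ∃ b < c.ord, Y ∩ Iio δ ⊆ codedBelow e δ b := by
  obtain ⟨b, hb, h⟩ := exists_bound_lt_ord hc (Y := e δ '' (Y ∩ Iio δ))
    (by rintro _ ⟨x, hx, rfl⟩; exact (he δ hδ).2 hx.2)
    (mk_image_le.trans_lt ((mk_le_mk_of_subset inter_subset_left).trans_lt hY))
  exact ⟨b, hb, fun x hx => ⟨hx.2, h _ ⟨x, hx, rfl⟩⟩⟩

theorem exists_coherent_codes {μ lam κ : Cardinal.{u}} (hμ : μ.IsRegular)
    (hlam : lam = Order.succ μ)
    {e : Ordinal.{u} → Ordinal.{u} → Ordinal.{u}}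
    (he : ∀ δ < κ.ord, InjOn (e δ) (Iio δ) ∧ MapsTo (e δ) (Iio δ) (Iio lam.ord)) :
    ∃ f : Ordinal.{u} → Ordinal.{u} → Ordinal.{u} → Ordinal.{u},
      (∀ δ i α, f δ i α < μ.ord) ∧
      (∀ δ < κ.ord, ∀ i < lam.ord, ∀ ν < μ.ord,
        #{α | α ∈ codedBelow e δ i ∧ f δ i α ≤ ν} < Cardinal.lift.{u + 1} μ) ∧
      ∀ δ < κ.ord, ∀ i < lam.ord, ∀ δ' < κ.ord, ∀ i' < lam.ord,
        #{α | α ∈ codedBelow e δ i ∧ α ∈ codedBelow e δ' i' ∧ f δ i α ≠ f δ' i' α} <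
          Cardinal.lift.{u + 1} μ := by
  have hreg : lam.IsRegular := hlam ▸ isRegular_succ hμ.aleph0_le
  have hμl : Cardinal.lift.{u + 1} μ < Cardinal.lift.{u + 1} lam :=
    Cardinal.lift_lt.2 (hlam ▸ Order.lt_succ μ)
  -- Domains are empty out of range, so the recursion can run over all pairs, lexicographically.
  let D : Ordinal.{u} ×ₗ Ordinal.{u} → Set Ordinal.{u} := fun p =>
    {α | (ofLex p).1 < κ.ord ∧ (ofLex p).2 < lam.ord ∧
      α ∈ codedBelow e (ofLex p).1 (ofLex p).2}
  have hD : ∀ p, #(D p) ≤ Cardinal.lift.{u + 1} μ := by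
    intro p
    by_cases h : (ofLex p).1 < κ.ord ∧ (ofLex p).2 < lam.ord
    · exact (mk_le_mk_of_subset fun x hx => hx.2.2).trans
        (mk_codedBelow_le (he _ h.1).1 (hlam ▸ h.2))
    · have : D p = ∅ := by
        ext x
        simp only [D, mem_ofPred_eq, mem_empty_iff_false, iff_false]
        exact fun hx => h ⟨hx.1, hx.2.1⟩
      simp [this]
  have hinf : ℵ₀ ≤ Cardinal.lift.{u + 1} μ := hμ.lift.aleph0_le
  have : Nonempty (Iio μ.ord) := ⟨⟨0, hμ.ord_pos⟩⟩
  obtain ⟨f, hf, hff⟩ := exists_coherent_family (M := Iio μ.ord) hμ.lift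
    (fun ν => (mk_le_of_injective (f := fun x : Iic ν => (⟨x.1.1, x.2⟩ : Iic ν.1))
      fun a b h => Subtype.ext (Subtype.ext (Subtype.mk.inj h))).trans_lt
        (mk_Iic_lt_lift hμ.aleph0_le ν.2)) D (by simpa only [mk_Iio_ord_eq] using hD) (by
    classical
    intro p
    rw [mk_Iio_ord_eq]
    by_cases hp : (ofLex p).1 < κ.ord ∧ (ofLex p).2 < lam.ord
    · have hb : ∀ a, ∃ b, a < κ.ord → b < lam.ord ∧ D p ∩ Iio a ⊆ codedBelow e a b := by
        intro a
        by_cases ha : a < κ.ord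
        · obtain ⟨b, hb⟩ := exists_code_bound hreg he ((hD p).trans_lt hμl) ha
          exact ⟨b, fun _ => hb⟩
        · exact ⟨0, fun h => absurd h ha⟩
      choose b hb using hb
      -- A single `s` serves all earlier first coordinates lying above every point of `D p`; the
      -- others lie below some `a ∈ D p`, and `(a, b a)` covers their trace.
      have hs : ∃ s, (∃ t < (ofLex p).1, D p ⊆ Iio t) → s < (ofLex p).1 ∧ D p ⊆ Iio s := by
        by_cases h : ∃ t < (ofLex p).1, D p ⊆ Iio t
        · exact ⟨h.choose, fun _ => h.choose_spec⟩
        · exact ⟨0, fun h' => absurd h' h⟩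
      obtain ⟨s, hs⟩ := hs
      have hcover : ∀ a < (ofLex p).1, D p ∩ Iio a ⊆ D (toLex (a, b a)) := fun a ha x hx =>
        ⟨ha.trans hp.1, (hb a (ha.trans hp.1)).1, (hb a (ha.trans hp.1)).2 hx⟩
      refine ⟨((fun a => toLex (a, b a)) '' D p ∪ {toLex (s, b s)} ∪
        (fun i => toLex ((ofLex p).1, i)) '' Iio (ofLex p).2) ∩ Iio p, inter_subset_right,
        (mk_le_mk_of_subset inter_subset_left).trans ?_, fun j hj => ?_⟩
      · refine (mk_union_le _ _).trans (add_le_of_le hinf ((mk_union_le _ _).trans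
          (add_le_of_le hinf (mk_image_le.trans (hD p)) ?_)) (mk_image_le.trans
            (mk_Iio_le_of_lt_ord_succ (hlam ▸ hp.2))))
        rw [mk_singleton]
        exact one_le_aleph0.trans hinf
      · rcases (Prod.Lex.lt_iff).1 hj with h | ⟨h, h'⟩
        · by_cases ha : ∃ a ∈ D p, (ofLex j).1 ≤ a
          · obtain ⟨a, ha, hja⟩ := ha
            refine ⟨toLex (a, b a), ⟨Or.inl (Or.inl ⟨a, ha, rfl⟩),
              Prod.Lex.lt_iff.2 (Or.inl ha.2.2.1)⟩, fun x hx => hcover a ha.2.2.1 ⟨hx.2, ?_⟩⟩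
            exact hx.1.2.2.1.trans_le hja
          · push Not at ha
            obtain ⟨hs1, hs2⟩ := hs ⟨_, h, ha⟩
            exact ⟨toLex (s, b s), ⟨Or.inl (Or.inr rfl), Prod.Lex.lt_iff.2 (Or.inl hs1)⟩,
              fun x hx => hcover s hs1 ⟨hx.2, hs2 hx.2⟩⟩
        · refine ⟨j, ⟨Or.inr ⟨(ofLex j).2, h', ?_⟩, hj⟩, inter_subset_left⟩
          exact congrArg toLex (Prod.ext h.symm rfl)
    · have : D p = ∅ := by
        ext x
        simp only [D, mem_ofPred_eq, mem_empty_iff_false, iff_false]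
        exact fun hx => hp ⟨hx.1, hx.2.1⟩
      by_cases h : ∃ j, j < p
      · obtain ⟨j, hj⟩ := h
        refine ⟨{j}, by simpa using hj, ?_, fun k hk => ⟨j, rfl, by simp [this]⟩⟩
        rw [mk_singleton]
        exact one_le_aleph0.trans hinf
      · exact ⟨∅, empty_subset _, by simp, fun j hj => absurd ⟨j, hj⟩ h⟩)
  refine ⟨fun δ i α => f (toLex (δ, i)) α, fun δ i α => (f _ α).2,
    fun δ hδ i hi ν hν => ?_, fun δ hδ i hi δ' hδ' i' hi' => ?_⟩
  · refine (mk_le_mk_of_subset ?_).trans_lt (hf (toLex (δ, i)) ⟨ν, hν⟩)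
    rintro x ⟨h1, h2⟩
    exact ⟨⟨hδ, hi, h1⟩, h2⟩
  · refine (mk_le_mk_of_subset ?_).trans_lt (hff (toLex (δ, i)) (toLex (δ', i')))
    rintro x ⟨h1, h2, h3⟩
    exact ⟨⟨hδ, hi, h1⟩, ⟨hδ', hi', h2⟩, fun h => h3 (congrArg Subtype.val h)⟩

/-! ### From the square-bracket relation to robustly attained colors. -/

/-- Cut `X` into `μ` disjoint pieces of size `μ`. Each piece has an image of size `μ` under `g`, so
it misses `τ` at fewer than `lam` many `z`. Beyond a common bound every piece attains `τ`, and `E`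
is too small to meet all pieces. -/
theorem exists_color_of_large {μ lam : Cardinal.{u}} (hμ : μ.IsRegular)
    (hlam : lam = Order.succ μ) {d : Ordinal.{u} → Ordinal.{u} → Ordinal.{u}}
    (hd : ∀ A B : Set Ordinal.{u}, A ⊆ Iio lam.ord → B ⊆ Iio lam.ord → HasCard A μ →
      HasCard B lam → (fun p : Ordinal.{u} × Ordinal.{u} => d p.1 p.2) '' incPairs A B =
        Iio lam.ord)
    {X : Set Ordinal.{u}} (hX : #X = Cardinal.lift.{u + 1} μ) {g : Ordinal.{u} → Ordinal.{u}}
    (hgμ : ∀ α, g α < μ.ord)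
    (hg : ∀ ν < μ.ord, #{α | α ∈ X ∧ g α ≤ ν} < Cardinal.lift.{u + 1} μ)
    {τ : Ordinal.{u}} (hτ : τ < lam.ord) :
    ∃ ε < lam.ord, ∀ z < lam.ord, ε < z → ∀ E : Set Ordinal.{u},
      #E < Cardinal.lift.{u + 1} μ → ∃ α ∈ X, α ∉ E ∧ g α < z ∧ d (g α) z = τ := by
  have hreg : lam.IsRegular := hlam ▸ isRegular_succ hμ.aleph0_le
  have hμl : μ < lam := hlam ▸ Order.lt_succ μ
  have hinf : ℵ₀ ≤ Cardinal.lift.{u + 1} μ := hμ.lift.aleph0_le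
  have hM : #(Iio μ.ord) = Cardinal.lift.{u + 1} μ := mk_Iio_ord_eq μ
  obtain ⟨φ⟩ : Nonempty (X ≃ Iio μ.ord × Iio μ.ord) := by
    rw [← Cardinal.eq, ← mul_def, hM, mul_eq_self hinf, hX]
  let P : Iio μ.ord → Set Ordinal.{u} := fun j => range fun k => (φ.symm (j, k) : Ordinal.{u})
  have hPX : ∀ j, P j ⊆ X := by
    rintro j _ ⟨k, rfl⟩
    exact (φ.symm (j, k)).2
  have hPcard : ∀ j, #(P j) = Cardinal.lift.{u + 1} μ := fun j => by
    rw [mk_range_eq _ fun k k' h => (Prod.ext_iff.1 (φ.symm.injective (Subtype.ext h))).2, hM]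
  have hAcard : ∀ j, HasCard (g '' P j) μ := by
    intro j
    refine le_antisymm (mk_image_le.trans (hPcard j).le) (le_of_not_gt fun h => ?_)
    refine (hPcard j).not_lt ((mk_le_mk_of_subset
      (t := ⋃ ν ∈ g '' P j, {α | α ∈ X ∧ g α ≤ ν}) fun x hx => ?_).trans_lt
      ((card_biUnion_lt_iff_forall_of_isRegular hμ.lift h).2 ?_))
    · exact mem_biUnion (mem_image_of_mem g hx) ⟨hPX j hx, le_rfl⟩
    · rintro _ ⟨y, -, rfl⟩
      exact hg _ (hgμ y)
  let B : Iio μ.ord → Set Ordinal.{u} := fun j =>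
    {z | z < lam.ord ∧ ∀ a ∈ g '' P j, a < z → d a z ≠ τ}
  have hB : ∀ j, #(B j) < Cardinal.lift.{u + 1} lam := by
    intro j
    refine lt_of_le_of_ne ((mk_le_mk_of_subset fun z hz => hz.1).trans (mk_Iio_ord_eq lam).le)
      fun h => ?_
    have himg := hd (g '' P j) (B j) (by
      rintro _ ⟨y, -, rfl⟩
      exact (hgμ y).trans (ord_lt_ord.2 hμl)) (fun z hz => hz.1) (hAcard j) h
    obtain ⟨⟨a, z⟩, ⟨ha, hz, haz⟩, hc⟩ := himg.ge hτ
    exact hz.2 a ha haz hc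
  obtain ⟨ε, hε, hεB⟩ := exists_bound_lt_ord hreg (Y := ⋃ j, B j)
    (iUnion_subset fun j z hz => hz.1)
    ((card_iUnion_lt_iff_forall_of_isRegular hreg.lift
      (hM.trans_lt (Cardinal.lift_lt.2 hμl))).2 hB)
  refine ⟨ε, hε, fun z hz hεz E hE => ?_⟩
  by_contra! hcon
  have hch : ∀ j, ∃ α ∈ P j, α ∈ E := by
    intro j
    have hzB : z ∉ B j := fun h => (hεB z (mem_iUnion.2 ⟨j, h⟩)).not_gt hεz
    have : ∃ a ∈ g '' P j, a < z ∧ d a z = τ := by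
      by_contra! h
      exact hzB ⟨hz, h⟩
    obtain ⟨_, ⟨α, hα, rfl⟩, h1, h2⟩ := this
    exact ⟨α, hα, by_contra fun h => hcon α (hPX j hα) h h1 h2⟩
  choose a haP haE using hch
  refine (hM.symm.trans_le (mk_le_of_injective (f := fun j => (⟨a j, haE j⟩ : E))
    fun j j' h => ?_)).not_gt hE
  obtain ⟨k, hk⟩ := haP j
  obtain ⟨k', hk'⟩ := haP j'
  have h' : a j = a j' := congrArg Subtype.val h
  exact (Prod.ext_iff.1 (φ.symm.injective (Subtype.ext (hk.trans (h'.trans hk'.symm))))).1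

/-! ### Consequences of condition U and of order type. -/

theorem exists_lt_of_restrictionWitnessesU {X Y : Set Ordinal.{u}} {k θ χ : Cardinal.{u}}
    {c : Ordinal.{u} → Ordinal.{u} → Ordinal.{u}} (hk : ℵ₀ ≤ k) (hχ : 1 < χ)
    (hU : RestrictionWitnessesU X k k θ χ c) (hYX : Y ⊆ X) (hY : HasCard Y k)
    {τ : Ordinal.{u}} (hτ : τ < θ.ord) : ∃ β ∈ Y, ∃ γ ∈ Y, β < γ ∧ τ < c β γ := by
  obtain ⟨π, hπ, rfl, -, hU⟩ := hU
  let Z : Set Ordinal.{u} := {ξ | ξ < k.ord ∧ π ξ ∈ Y}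
  have hZY : π '' Z = Y := by
    ext y
    refine ⟨?_, fun hy => ?_⟩
    · rintro ⟨ξ, hξ, rfl⟩
      exact hξ.2
    · obtain ⟨ξ, hξ, rfl⟩ := hYX hy
      exact ⟨ξ, ⟨hξ, hy⟩, rfl⟩
  have hZ : #Z = Cardinal.lift.{u + 1} k := by
    rw [← hY, ← hZY, mk_image_eq_of_injOn]
    exact hπ.injOn.mono fun ξ hξ => hξ.1
  -- Singletons suffice here: two members of `G` give the pair.
  obtain ⟨G, hGF, hG, hGc⟩ := hU 1 hχ ((fun ξ => {ξ}) '' Z)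
    (by
      rintro _ ⟨ξ, hξ, rfl⟩
      exact ⟨singleton_subset_iff.2 hξ.1, by simp [HasCard]⟩)
    (by
      rintro _ ⟨ξ, -, rfl⟩ _ ⟨η, -, rfl⟩ h
      exact disjoint_singleton.2 fun h' => h (congrArg _ h'))
    (by rw [HasCard, mk_image_eq singleton_injective, hZ]) τ hτ
  have h1 : 1 < #G := by
    rw [hG]
    exact one_lt_aleph0.trans_le (by simpa using hk)
  have : Nontrivial G := one_lt_iff_nontrivial.1 h1
  obtain ⟨⟨a, ha⟩, ⟨b, hb⟩, hab⟩ := exists_pair_ne G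
  obtain ⟨ξ, hξ, rfl⟩ := hGF ha
  obtain ⟨η, hη, rfl⟩ := hGF hb
  have hlt := hGc _ ha _ hb (fun h => hab (Subtype.ext h)) ξ rfl η rfl
  have hne : ξ ≠ η := fun h => hab (by subst h; rfl)
  rcases hne.lt_or_gt with h | h
  · rw [min_eq_left h.le, max_eq_right h.le] at hlt
    exact ⟨π ξ, hξ.2, π η, hη.2, hπ hξ.1 hη.1 h, hlt⟩
  · rw [min_eq_right h.le, max_eq_left h.le] at hlt
    exact ⟨π η, hη.2, π ξ, hξ.2, hπ hη.1 hξ.1 h, hlt⟩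

theorem mk_inter_Iic_lt {X : Set Ordinal.{u}} {k : Cardinal.{u}} (hk : ℵ₀ ≤ k)
    {π : Ordinal.{u} → Ordinal.{u}} (hπ : StrictMonoOn π (Iio k.ord)) (hX : π '' Iio k.ord = X)
    {x : Ordinal.{u}} (hx : x ∈ X) : #(X ∩ Iic x : Set Ordinal.{u}) < Cardinal.lift.{u + 1} k := by
  subst hX
  obtain ⟨ξ, hξ, rfl⟩ := hx
  refine (mk_le_mk_of_subset (t := π '' Iic ξ) ?_).trans_lt
    (mk_image_le.trans_lt (mk_Iic_lt_lift hk hξ))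
  rintro _ ⟨⟨η, hη, rfl⟩, h⟩
  exact ⟨η, (hπ.le_iff_le hη hξ).1 h, rfl⟩

theorem HasOrderType.hasCard {A : Set Ordinal.{u}} {k : Cardinal.{u}}
    (h : HasOrderType A k.ord) : HasCard A k := by
  have := congrArg Ordinal.card h
  rwa [card_type, ← lift_card, card_ord] at this

/-! ### The coloring of triples. -/

theorem mainTheorem6 (μ lam κ : Cardinal.{u})
    (hμ : ℵ₀ ≤ μ) (hpow : μ ^< μ = μ)
    (hlam : lam = Order.succ μ) (hκ : κ = Order.succ lam)
    (rho : Ordinal.{u} → Ordinal.{u} → Ordinal.{u})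
    (hrho : IsPairColoring κ lam rho) (hsub : IsSubadditive κ rho)
    (hneg : NegSquareBracket lam μ lam lam) :
    ∃ c : Ordinal.{u} → Ordinal.{u} → Ordinal.{u} → Ordinal.{u},
      IsTripleColoring κ lam c ∧
      ∀ τ < lam.ord, ∀ A B : Set Ordinal.{u},
        A ⊆ Iio κ.ord → B ⊆ Iio κ.ord → Disjoint A B →
        HasOrderType A lam.ord → HasOrderType B lam.ord →
        sSup A = sSup B →
        RestrictionWitnessesU (A ∪ B) lam lam lam 3 rho →
        ∃ α β γ : Ordinal.{u},
          (α, β, γ) ∈ incTriples (A ∪ B) \ (incTriples A ∪ incTriples B) ∧ c α β γ = τ := by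
  classical
  have hμr := isRegular_of_powerlt_eq hμ hpow
  have hreg : lam.IsRegular := hlam ▸ isRegular_succ hμ
  have hμl : μ < lam := hlam ▸ Order.lt_succ μ
  have hμl' : Cardinal.lift.{u + 1} μ < Cardinal.lift.{u + 1} lam := Cardinal.lift_lt.2 hμl
  have hlim : Order.IsSuccLimit lam.ord := isSuccLimit_ord hreg.aleph0_le
  have hκr : κ.IsRegular := hκ ▸ isRegular_succ hreg.aleph0_le
  have hlκ : lam < κ := hκ ▸ Order.lt_succ lam
  obtain ⟨d, hdcol, hd⟩ := hneg
  obtain ⟨e, he⟩ := exists_injOn_Iio lam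
  rw [← hκ] at he
  obtain ⟨f, hfμ, hf, hff⟩ := exists_coherent_codes (κ := κ) hμr hlam he
  -- Including `e γ β` makes a bound on `z` a bound on codes as well.
  let z : Ordinal.{u} → Ordinal.{u} → Ordinal.{u} := fun β γ => max (rho β γ) (e γ β)
  have hz : ∀ β γ, β < γ → γ < κ.ord → z β γ < lam.ord := fun β γ h hγ =>
    max_lt (hrho (β, γ) ⟨h.trans hγ, hγ, h⟩) ((he γ hγ).2 h)
  -- The successor is there because `codedBelow` is strict, while codes equal to `z β γ` must be
  -- admitted.
  let c : Ordinal.{u} → Ordinal.{u} → Ordinal.{u} → Ordinal.{u} := fun α β γ =>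
    if f β (Order.succ (z β γ)) α < z β γ then d (f β (Order.succ (z β γ)) α) (z β γ) else 0
  have hc : IsTripleColoring κ lam c := by
    rintro ⟨α, β, γ⟩ ⟨-, -, hγ, hαβ, hβγ⟩
    dsimp only [c]
    split_ifs with h
    · have hzl := hz β γ hβγ hγ
      exact hdcol (_, _) ⟨h.trans hzl, hzl, h⟩
    · exact hreg.ord_pos
  have key : ∀ τ < lam.ord, ∀ X ⊆ Iio κ.ord, #X = Cardinal.lift.{u + 1} μ →
      ∃ ε < lam.ord, ∀ β γ, β < γ → γ < κ.ord → (∀ α ∈ X, α < β ∧ e β α ≤ z β γ) →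
        ε < z β γ → ∃ α ∈ X, c α β γ = τ := by
    intro τ hτ X hXκ hX
    obtain ⟨δ, hδ, hXδ⟩ := exists_bound_lt_ord hκr hXκ
      (hX.trans_lt (Cardinal.lift_lt.2 (hμl.trans hlκ)))
    obtain ⟨i, hi, hXi⟩ := exists_code_bound hreg he (hX.trans_lt hμl') hδ
    have hXD : ∀ α ∈ X, α ∈ codedBelow e δ i := fun α hα => hXi ⟨hα, hXδ α hα⟩
    obtain ⟨ε, hε, h⟩ := exists_color_of_large hμr hlam hd hX (hfμ δ i)
      (fun ν hν => (mk_le_mk_of_subset (t := {α | α ∈ codedBelow e δ i ∧ f δ i α ≤ ν})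
        fun α hα => ⟨hXD α hα.1, hα.2⟩).trans_lt
        (hf δ hδ i hi ν hν)) hτ
    refine ⟨ε, hε, fun β γ hβγ hγ hαβ hεz => ?_⟩
    have hzl := hz β γ hβγ hγ
    obtain ⟨α, hα, hαE, hlt, hdα⟩ := h (z β γ) hzl hεz _
      (hff δ hδ i hi β (hβγ.trans hγ) (Order.succ (z β γ)) (hlim.succ_lt hzl))
    have heq : f δ i α = f β (Order.succ (z β γ)) α := by
      by_contra hne
      exact hαE ⟨hXD α hα, ⟨(hαβ α hα).1, Order.lt_succ_iff.2 (hαβ α hα).2⟩, hne⟩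
    refine ⟨α, hα, ?_⟩
    dsimp only [c]
    rw [← heq, if_pos hlt, hdα]
  refine ⟨c, hc, fun τ hτ A B hA hB hdisj hoA hoB _ hU => ?_⟩
  have hcA : HasCard A lam := hoA.hasCard
  have hcB : HasCard B lam := hoB.hasCard
  have hXκ : A ∪ B ⊆ Iio κ.ord := union_subset hA hB
  have hseg : ∀ x ∈ A ∪ B, #((A ∪ B) ∩ Iic x : Set Ordinal.{u}) < Cardinal.lift.{u + 1} lam := by
    obtain ⟨π, hπ, hX, -⟩ := hU
    exact fun x hx => mk_inter_Iic_lt hreg.aleph0_le hπ hX hx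
  have htail : ∀ Y ⊆ A ∪ B, HasCard Y lam → ∀ Z ⊆ A ∪ B, #Z < Cardinal.lift.{u + 1} lam →
      HasCard {y | y ∈ Y ∧ ∀ z ∈ Z, z < y} lam := by
    intro Y hYX hY Z hZX hZ
    refine le_antisymm ((mk_le_mk_of_subset fun y hy => hy.1).trans hY.le)
      (le_of_not_gt fun h => hY.not_lt ?_)
    refine (mk_le_mk_of_subset (t := {y | y ∈ Y ∧ ∀ z ∈ Z, z < y} ∪
      ⋃ z ∈ Z, (A ∪ B) ∩ Iic z) fun y hy => ?_).trans_lt ((mk_union_le _ _).trans_lt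
        (add_lt_of_lt hreg.lift.aleph0_le h
          ((card_biUnion_lt_iff_forall_of_isRegular hreg.lift hZ).2 fun z hz => hseg z (hZX hz))))
    by_cases hy' : ∀ z ∈ Z, z < y
    · exact Or.inl ⟨hy, hy'⟩
    · push Not at hy'
      obtain ⟨z, hzZ, hzy⟩ := hy'
      exact Or.inr (mem_biUnion hzZ ⟨hYX hy, hzy⟩)
  have hmem : ∀ α ∈ A, ∀ β ∈ A ∪ B, ∀ γ ∈ B, α < β → β < γ →
      (α, β, γ) ∈ incTriples (A ∪ B) \ (incTriples A ∪ incTriples B) := by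
    intro α hα β hβ γ hγ hαβ hβγ
    refine ⟨⟨Or.inl hα, hβ, Or.inr hγ, hαβ, hβγ⟩, ?_⟩
    rintro (⟨-, -, h, -⟩ | ⟨h, -⟩)
    · exact disjoint_left.1 hdisj h hγ
    · exact disjoint_left.1 hdisj hα h
  obtain ⟨A₀, hA₀A, hA₀⟩ := le_mk_iff_exists_subset.1 (hμl'.le.trans hcA.ge)
  have hA₀X : A₀ ⊆ A ∪ B := hA₀A.trans subset_union_left
  by_cases hunb : ∃ β ∈ A ∪ B, (∀ α ∈ A₀, α < β) ∧
      ∀ ε < lam.ord, ∃ γ ∈ B, β < γ ∧ ε < z β γ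
  · obtain ⟨β, hβ, hβA, hβu⟩ := hunb
    obtain ⟨ε, hε, h⟩ := key τ hτ A₀ (hA₀A.trans hA) hA₀
    -- As `β` is fixed, the codes of `A₀` at `β` have a bound, which some `z β γ` exceeds.
    obtain ⟨ε', hε', hb⟩ := exists_code_bound hreg he (hA₀.trans_lt hμl') (hXκ hβ)
    obtain ⟨γ, hγ, hβγ, hzγ⟩ := hβu (max ε ε') (max_lt hε hε')
    obtain ⟨α, hα, hcα⟩ := h β γ hβγ (hB hγ) (fun α hα => ⟨hβA α hα,
      ((hb ⟨hα, hβA α hα⟩).2.trans ((le_max_right _ _).trans_lt hzγ)).le⟩)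
      ((le_max_left _ _).trans_lt hzγ)
    exact ⟨α, β, γ, hmem α (hA₀A hα) β hβ γ hγ (hβA α hα) hβγ, hcα⟩
  · push Not at hunb
    have hbd : ∀ β, ∃ ε, β ∈ A ∪ B → (∀ α ∈ A₀, α < β) →
        ε < lam.ord ∧ ∀ γ ∈ B, β < γ → z β γ ≤ ε := by
      intro β
      by_cases h : β ∈ A ∪ B ∧ ∀ α ∈ A₀, α < β
      · obtain ⟨ε, hε⟩ := hunb β h.1 h.2
        exact ⟨ε, fun _ _ => hε⟩
      · exact ⟨0, fun h1 h2 => absurd ⟨h1, h2⟩ h⟩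
    choose b hb using hbd
    -- Placing `A₁` above `A₀` makes the bounds `b` available at its own points: `e β α ≤ z α β ≤ b
    -- α` for `α ∈ A₁` and every larger `β ∈ B`.
    obtain ⟨A₁, hA₁A, hA₁⟩ := le_mk_iff_exists_subset.1
      (hμl'.le.trans (htail A subset_union_left hcA A₀ hA₀X (hA₀.trans_lt hμl')).ge)
    have hA₁X : A₁ ⊆ A ∪ B := fun α hα => Or.inl (hA₁A hα).1
    have hb' := fun α (hα : α ∈ A₁) => hb α (hA₁X hα) (hA₁A hα).2
    obtain ⟨ε, hε, h⟩ := key τ hτ A₁ (hA₁X.trans hXκ) hA₁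
    obtain ⟨ε', hε', hεb⟩ := exists_bound_lt_ord hreg (Y := b '' A₁)
      (by rintro _ ⟨α, hα, rfl⟩; exact (hb' α hα).1)
      (mk_image_le.trans_lt (hA₁.trans_lt hμl'))
    obtain ⟨β, hβ, γ, hγ, hβγ, hlt⟩ := exists_lt_of_restrictionWitnessesU hreg.aleph0_le
      (by norm_num) hU (fun y hy => Or.inr hy.1)
      (htail B subset_union_right hcB A₁ hA₁X (hA₁.trans_lt hμl')) (max_lt hε hε')
    have hzlt : max ε ε' < z β γ := hlt.trans_le (le_max_left _ _)
    obtain ⟨α, hα, hcα⟩ := h β γ hβγ (hB hγ.1) (fun α hα => ⟨hβ.2 α hα,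
      (((le_max_right _ _).trans ((hb' α hα).2 β hβ.1 (hβ.2 α hα))).trans
        (hεb _ ⟨α, hα, rfl⟩).le).trans ((le_max_right _ _).trans_lt hzlt).le⟩)
      ((le_max_left _ _).trans_lt hzlt)
    exact ⟨α, β, γ, hmem α (hA₁A hα).1 β (Or.inr hβ.1) γ hγ.1 (hβ.2 α hα) hβγ, hcα⟩
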